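/- For a family $\mathcal F$ of subsets of $[n]=\{1,\dots,n\}$, the Lubell mass $\ell(\mathcal F)$ is the expected number of members of $\mathcal F$ on a uniformly random maximal chain of the Boolean lattice $2^{[n]}$; equivalently, $\ell(\mathcal F)=\sum_{A\in\mathcal F}\binom{n}{|A|}^{-1}$. The family $\mathcal F$ contains an induced copy of a poset $P$ if there is a map $\varphi:P\to\mathcal F$ with $x\le y$ if and only if $\varphi(x)\subseteq\varphi(y)$ for all $x,y\in P$; otherwise $\mathcal F$ is $P$-free. Let $\mathrm{La}^*(n,P)$ be the maximum size of a $P$-free family of subsets of $[n]$ (taken to be $0$ if $P$ is empty), and let $\Lambda^*(P)$ be the supremum of $\ell(\mathcal F)$ over all $n\ge 0$ and all $P$-free families $\mathcal F$ of subsets of $[n]$. The height of $P$ is the maximum size of a chain in $P$. **Theorem.** Let $P$ be an $r$-element poset of height at most $2$. Then $$\Lambda^*(P)\le 4r+\sqrt{(32\ln 2)\,r}+6;$$ that is, for every $n$, every family of subsets of $[n]$ with Lubell mass greater than $4r+\sqrt{(32\ln 2)\,r}+6$ contains an induced copy of $P$. Consequently, there is an absolute constant $C>0$ such that for every $r$,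 every $r$-element poset $P$ of height at most $2$ and every $n$, $$\mathrm{La}^*(n,P)\le \bigl(4r+C\sqrt r\bigr)\binom{n}{\lfloor n/2\rfloor}.$$ -/

import Mathlib

namespace InducedTuran

open Finset

universe u

/-- The height of a poset: the maximum size of a chain. -/
noncomputable def posetHeight (P : Type u) [PartialOrder P] : ℕ∞ :=
  (Set.univ : Set P).chainHeight (· ≤ ·)

/-- `F`, ordered by inclusion, contains `P` as an induced subposet. -/
def ContainsCopy {n : ℕ} (F : Finset (Finset (Fin n))) (P : Type u) [PartialOrder P] : Prop :=
  Nonempty (P ↪o {A : Finset (Fin n) // A ∈ F})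

/-- `F` contains no induced copy of `P`. -/
def IsFree {n : ℕ} (F : Finset (Finset (Fin n))) (P : Type u) [PartialOrder P] : Prop :=
  ¬ ContainsCopy F P

/-- There are finitely many maximal chains of subsets of an `n`-element set. -/
noncomputable instance flagFintype (n : ℕ) : Fintype (Flag (Finset (Fin n))) :=
  have : Finite (Flag (Finset (Fin n))) :=
    Finite.of_injective (fun c : Flag (Finset (Fin n)) => (c : Set (Finset (Fin n))))
      SetLike.coe_injective
  Fintype.ofFinite _

open Classical in
/-- The Lubell mass of `F`: the expected number of members of `F` on a maximal chain of subsets of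
an `n`-element set, chosen uniformly at random (`Flag` is the type of maximal chains). -/
noncomputable def lubellMass {n : ℕ} (F : Finset (Finset (Fin n))) : ℝ :=
  (∑ c : Flag (Finset (Fin n)), (#{A ∈ F | A ∈ c} : ℝ)) / Fintype.card (Flag (Finset (Fin n)))

open Classical in
/-- `La*(n, P)`: the maximum size of a `P`-free family of subsets of an `n`-element set
(`0` if there is none, which happens only for empty `P`). -/
noncomputable def turanNumber (n : ℕ) (P : Type u) [PartialOrder P] : ℕ :=
  ({F : Finset (Finset (Fin n)) | IsFree F P} : Finset (Finset (Finset (Fin n)))).sup card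

/-- The strong Lubell threshold `Λ*(P)`: the supremum of the Lubell masses of all `P`-free families
of subsets of `n`-element sets, over all `n`, taken in the extended reals. -/
noncomputable def strongLubellThreshold (P : Type u) [PartialOrder P] : EReal :=
  ⨆ (n : ℕ) (F : Finset (Finset (Fin n))) (_ : IsFree F P), (lubellMass F : EReal)

/-! A maximal chain contains exactly one set of each size, and by symmetry all sets of the same size
are on equally many maximal chains; this gives the formula for the Lubell mass. -/

theorem exists_mem_flag_card {n : ℕ} (c : Flag (Finset (Fin n))) {k : ℕ} (hk : k ≤ n) :
    ∃ A ∈ c, #A = k := by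
  classical
  by_contra! hcon
  let cf : Finset (Finset (Fin n)) := {A | A ∈ c}
  obtain ⟨B, hB, hBmax⟩ := exists_max_image (cf.filter fun A => #A ≤ k) card
    ⟨∅, by simpa [cf] using c.bot_mem⟩
  obtain ⟨D, hD, hDmin⟩ := exists_min_image (cf.filter fun A => k ≤ #A) card
    ⟨univ, by simpa [cf] using ⟨c.top_mem, hk⟩⟩
  simp only [cf, mem_filter, mem_univ, true_and] at hB hD hBmax hDmin
  have key : ∀ A ∈ c, A ⊆ B ∨ D ⊆ A := by
    intro A hA
    rcases le_total (#A) k with h | h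
    · left
      rcases c.le_or_le hA hB.1 with h' | h'
      · exact h'
      · exact (eq_of_subset_of_card_le h' (hBmax A ⟨hA, h⟩)).ge
    · right
      rcases c.le_or_le hD.1 hA with h' | h'
      · exact h'
      · exact (eq_of_subset_of_card_le h' (hDmin A ⟨hA, h⟩)).ge
  have hBD : B ⊆ D := by
    rcases c.le_or_le hB.1 hD.1 with h' | h'
    · exact h'
    · exact (eq_of_subset_of_card_le h' (hB.2.trans hD.2)).ge
  obtain ⟨E, hBE, hED, hE⟩ := exists_subsuperset_card_eq hBD hB.2 hD.2
  refine hcon E ?_ hE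
  have hch : IsChain (· ≤ ·) (insert E (c : Set (Finset (Fin n)))) := by
    refine c.chain_le.insert fun A hA _ => ?_
    rcases key A hA with h | h
    · exact Or.inr (h.trans hBE)
    · exact Or.inl (hED.trans h)
  have := c.max_chain' hch (Set.subset_insert _ _)
  exact (Set.ext_iff.1 this E).2 (Set.mem_insert _ _)

open Classical in
theorem card_flag_mem_eq {n : ℕ} {A B : Finset (Fin n)} (h : #A = #B) :
    #{c : Flag (Finset (Fin n)) | A ∈ c} = #{c : Flag (Finset (Fin n)) | B ∈ c} := by
  obtain ⟨e, he⟩ : ∃ e : Equiv.Perm (Fin n), A.map e.toEmbedding = B := by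
    let e := A.equivOfCardEq h
    refine ⟨e.extendSubtype, ?_⟩
    refine eq_of_subset_of_card_le ?_ (by simp [h])
    intro x hx
    obtain ⟨a, ha, rfl⟩ := mem_map.1 hx
    exact e.extendSubtype_mem a ha
  let f : Finset (Fin n) ≃o Finset (Fin n) :=
    { e.finsetCongr with map_rel_iff' := by simp }
  have hf : ∀ X, f X = X.map e.toEmbedding := fun _ => rfl
  refine card_equiv (Flag.map f) fun c => ?_
  simp only [mem_filter, mem_univ, true_and]
  rw [← SetLike.mem_coe (p := Flag.map _ c), Flag.coe_map]
  constructor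
  · exact fun hA => ⟨A, hA, he⟩
  · rintro ⟨A', hA', hh⟩
    have : A' = A := by
      apply Finset.map_injective e.toEmbedding
      rw [he, ← hf, hh]
    exact this ▸ hA'

open Classical in
theorem choose_mul_card_flag_mem {n : ℕ} (A : Finset (Fin n)) :
    n.choose #A * #{c : Flag (Finset (Fin n)) | A ∈ c}
      = Fintype.card (Flag (Finset (Fin n))) := by
  have hA : #A ≤ n := by simpa using card_le_univ A
  have h1 : ∑ B ∈ powersetCard #A (univ : Finset (Fin n)),
      #{c : Flag (Finset (Fin n)) | B ∈ c}
      = n.choose #A * #{c : Flag (Finset (Fin n)) | A ∈ c} := by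
    rw [sum_congr rfl fun B hB => card_flag_mem_eq (mem_powersetCard.1 hB).2]
    simp
  rw [← h1]
  have h2 : ∀ c : Flag (Finset (Fin n)),
      #{B ∈ powersetCard #A (univ : Finset (Fin n)) | B ∈ c} = 1 := by
    intro c
    obtain ⟨E, hE, hEc⟩ := exists_mem_flag_card c hA
    refine card_eq_one.2 ⟨E, ?_⟩
    ext B
    simp only [mem_filter, mem_powersetCard, subset_univ, true_and, mem_singleton]
    constructor
    · rintro ⟨hB, hBc⟩
      rcases c.le_or_le hBc hE with h | h
      · exact eq_of_subset_of_card_le h (by omega)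
      · exact (eq_of_subset_of_card_le h (by omega)).symm
    · rintro rfl
      exact ⟨hEc, hE⟩
  simp only [card_filter] at h2 ⊢
  rw [sum_comm, sum_congr rfl fun c _ => h2 c]
  simp

/-- The Lubell mass of `F` is the sum of `1 / (n choose |A|)` over the members `A` of `F`. -/
theorem lubellMass_eq_sum {n : ℕ} (F : Finset (Finset (Fin n))) :
    lubellMass F = ∑ A ∈ F, 1 / (n.choose #A : ℝ) := by
  classical
  have hswap : (∑ c : Flag (Finset (Fin n)), (#{A ∈ F | A ∈ c} : ℝ))
      = ∑ A ∈ F, (#{c : Flag (Finset (Fin n)) | A ∈ c} : ℝ) := by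
    simp only [card_filter]
    push_cast
    rw [sum_comm]
  have hne : Nonempty (Flag (Finset (Fin n))) := by
    obtain ⟨c, hc, -⟩ := (IsChain.empty : IsChain (· ≤ ·) (∅ : Set (Finset (Fin n)))).exists_maxChain
    exact ⟨Flag.ofIsMaxChain c hc⟩
  have hpos : (Fintype.card (Flag (Finset (Fin n))) : ℝ) ≠ 0 := by
    exact_mod_cast Fintype.card_ne_zero
  rw [lubellMass]
  have : (∑ c : Flag (Finset (Fin n)), (#{A ∈ F | A ∈ c} : ℝ))
      / Fintype.card (Flag (Finset (Fin n)))
      = ∑ A ∈ F, (#{c : Flag (Finset (Fin n)) | A ∈ c} : ℝ)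
        / Fintype.card (Flag (Finset (Fin n))) := by
    rw [hswap, sum_div]
  convert this using 1
  refine sum_congr rfl fun A _ => ?_
  have hA : #A ≤ n := by simpa using card_le_univ A
  have hch : (n.choose #A : ℝ) ≠ 0 := by exact_mod_cast (Nat.choose_pos hA).ne'
  rw [div_eq_div_iff hch hpos, one_mul, mul_comm]
  exact_mod_cast (choose_mul_card_flag_mem A).symm

end InducedTuran

namespace InducedTuran

open Finset

/-! Cut the family at the middle level; complementation and the dual poset reduce the upper half to
the lower one. So let every member of F have size at most n/2, and call x ∈ A a pivot of A if some B
∈ F of the same size has A \ B = {x}. If x is not a pivot of A, then A \ {x} determines both A and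
x. Counting level by level, the proportions of nonpivots on a random maximal chain have expected sum
at most ∑ 1/(n - j) ≤ ln 2 (`sum_nonpivots_le_log_two`). Put a² = 2r and b² = ln 2. By Markov, the
sets with nonpivot proportion above b/(a+b) have mass at most b(a+b). If F has mass above (a+b)²,
the rest, G, has mass above a(a+b), and so has the part of G below some A ∈ G
(`relMass_le_of_forall_mem`). A weighted Sauer-Shelah argument then shatters r pivots of A by
members of G below A (`exists_shatters_of_lt_relMass`), and such pivots encode P
(`containsCopy_of_shatters`). The two halves together cost 2(a+b)² = 4r + √(32 r ln 2) + 2 ln 2. -/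

/-- The Lubell mass, relative to the ground set `X`, of the members of `F` contained in `X`. -/
noncomputable def relMass {α : Type*} [DecidableEq α] (F : Finset (Finset α)) (X : Finset α) : ℝ :=
  ∑ S ∈ F with S ⊆ X, 1 / ((#X).choose #S : ℝ)

/-! ### Mass below a set, via random chains. -/

section RelMass

variable {α : Type*} [DecidableEq α]

theorem sub_mul_one_div_choose_pred (N s : ℕ) (h : s < N) :
    ((N : ℝ) - s) * (1 / ((N - 1).choose s : ℝ)) = N * (1 / (N.choose s : ℝ)) := by
  obtain ⟨M, rfl⟩ : ∃ M, N = M + 1 := ⟨N - 1, by omega⟩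
  have hs : s ≤ M := by omega
  have h1 : (M.choose s : ℝ) ≠ 0 := by exact_mod_cast (Nat.choose_pos hs).ne'
  have h2 : ((M + 1).choose s : ℝ) ≠ 0 := by exact_mod_cast (Nat.choose_pos (by omega)).ne'
  have h3 := Nat.choose_mul_succ_eq M s
  have h4 : (M.choose s : ℝ) * (M + 1) = (M + 1).choose s * ((M : ℝ) + 1 - s) := by
    have : ((M + 1 - s : ℕ) : ℝ) = (M : ℝ) + 1 - s := by
      push_cast [Nat.cast_sub (by omega : s ≤ M + 1)]; ring
    rw [← this]; exact_mod_cast h3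
  simp only [Nat.add_sub_cancel]
  push_cast
  field_simp
  linarith

/-- A uniformly random maximal chain below `X` continues through `X.erase x` with `x ∈ X` uniformly
random. -/
theorem card_mul_relMass (F : Finset (Finset α)) (X : Finset α) :
    (#X : ℝ) * relMass F X
      = #X * (if X ∈ F then 1 else 0) + ∑ x ∈ X, relMass F (X.erase x) := by
  classical
  have hsum : ∑ x ∈ X, relMass F (X.erase x)
      = ∑ S ∈ F with S ⊂ X, (#X : ℝ) * (1 / ((#X).choose #S : ℝ)) := by
    unfold relMass
    have h1 : ∀ x ∈ X, ∑ S ∈ F with S ⊆ X.erase x, 1 / ((#(X.erase x)).choose #S : ℝ)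
        = ∑ S ∈ F with S ⊂ X, if x ∉ S then 1 / ((#X - 1).choose #S : ℝ) else 0 := by
      intro x hx
      rw [← sum_filter, filter_filter, card_erase_of_mem hx]
      refine sum_congr (filter_congr fun S _ => ?_) fun _ _ => rfl
      rw [subset_erase]
      constructor
      · rintro ⟨h, hxS⟩
        exact ⟨⟨h, fun h' => hxS (h' hx)⟩, hxS⟩
      · rintro ⟨h, hxS⟩
        exact ⟨h.1, hxS⟩
    rw [sum_congr rfl h1, sum_comm]
    refine sum_congr rfl fun S hS => ?_
    have hS := (mem_filter.1 hS).2
    rw [← sum_filter, sum_const, nsmul_eq_mul, ← sub_mul_one_div_choose_pred _ _ (card_lt_card hS)]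
    congr 1
    have : X.filter (fun x => x ∉ S) = X \ S := by ext; simp
    rw [this, card_sdiff_of_subset hS.1, Nat.cast_sub (card_le_card hS.1)]
  have hsplit : relMass F X = (if X ∈ F then 1 else 0)
      + ∑ S ∈ F with S ⊂ X, 1 / ((#X).choose #S : ℝ) := by
    unfold relMass
    rw [← sum_filter_add_sum_filter_not _ (fun S => S = X), filter_filter, filter_filter]
    congr 1
    · by_cases hX : X ∈ F
      · have : F.filter (fun S => S ⊆ X ∧ S = X) = {X} := by
          ext S; simp only [mem_filter, mem_singleton]
          constructor
          · exact fun h => h.2.2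
          · rintro rfl; exact ⟨hX, subset_rfl, rfl⟩
        rw [this]; simp [hX]
      · rw [if_neg hX, filter_false_of_mem, sum_empty]
        rintro S hS ⟨-, rfl⟩
        exact hX hS
    · refine sum_congr (filter_congr fun S _ => ?_) fun _ _ => rfl
      rw [ssubset_iff_subset_ne]
  rw [hsplit, hsum, mul_add, mul_sum]

theorem relMass_empty (F : Finset (Finset α)) :
    relMass F (∅ : Finset α) = if ∅ ∈ F then 1 else 0 := by
  unfold relMass
  simp only [subset_empty]
  rw [filter_eq']
  split_ifs <;> simp

/-- The mass below any set is at most the largest mass below a member of the family. -/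
theorem relMass_le_of_forall_mem (F : Finset (Finset α)) {c : ℝ} (hc : 0 ≤ c)
    (h : ∀ A ∈ F, relMass F A ≤ c) (X : Finset α) : relMass F X ≤ c := by
  induction X using Finset.strongInduction with
  | H X ih =>
    by_cases hX : X ∈ F
    · exact h X hX
    rcases X.eq_empty_or_nonempty with rfl | hne
    · rw [relMass_empty, if_neg hX]; exact hc
    have hpos : (0 : ℝ) < #X := by exact_mod_cast hne.card_pos
    have h1 := card_mul_relMass F X
    have h2 : ∑ x ∈ X, relMass F (X.erase x) ≤ ∑ _x ∈ X, c :=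
      sum_le_sum fun x hx => ih _ (erase_ssubset hx)
    rw [sum_const, nsmul_eq_mul] at h2
    rw [if_neg hX] at h1
    refine le_of_mul_le_mul_left ?_ hpos
    linarith

/-- A random maximal chain has few members that meet `W` in exactly `i` points. -/
theorem relMass_card_inter_eq_le [Fintype α] (W : Finset α) (i : ℕ) (X : Finset α) :
    relMass (univ.filter fun T => #(T ∩ W) = i) X ≤ ((#X : ℝ) + 1) / (#(X ∩ W) + 1) := by
  -- Heuristically, with w = #(X ∩ W): in a random deletion order the w points cut the others into w
  -- + 1 exchangeable gaps of mean length (#X - w)/(w + 1). The sets with a given trace size form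
  -- one gap plus one set, whence (#X + 1)/(w + 1).
  induction X using Finset.strongInduction with
  | H X ih =>
    rcases lt_or_ge (#(X ∩ W)) i with hlt | hge
    · have : relMass (univ.filter fun T => #(T ∩ W) = i) X = 0 := by
        unfold relMass
        rw [filter_false_of_mem, sum_empty]
        intro S hS hSX
        have := card_le_card (inter_subset_inter_right hSX : S ∩ W ⊆ X ∩ W)
        have := (mem_filter.1 hS).2
        omega
      rw [this]; positivity
    rcases X.eq_empty_or_nonempty with rfl | hne
    · rw [relMass_empty]
      split_ifs <;> simp
    have hpos : (0 : ℝ) < #X := by exact_mod_cast hne.card_pos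
    have h1 := card_mul_relMass (univ.filter fun T => #(T ∩ W) = i) X
    rw [← sum_inter_add_sum_sdiff X W] at h1
    have hcard : #(X ∩ W) + #(X \ W) = #X := card_inter_add_card_sdiff X W
    have hcardR : (#(X ∩ W) : ℝ) + #(X \ W) = #X := by exact_mod_cast hcard
    have herase : ∀ x ∈ X, ((#(X.erase x) : ℝ)) + 1 = #X := by
      intro x hx
      exact_mod_cast card_erase_add_one hx
    have hout : ∑ x ∈ X \ W, relMass (univ.filter fun T => #(T ∩ W) = i) (X.erase x)
        ≤ #(X \ W) * ((#X : ℝ) / (#(X ∩ W) + 1)) := by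
      rw [← nsmul_eq_mul, ← sum_const]
      refine sum_le_sum fun x hx => ?_
      obtain ⟨hxX, hxW⟩ := mem_sdiff.1 hx
      have := ih _ (erase_ssubset hxX)
      rwa [herase x hxX, erase_inter, erase_eq_of_notMem (s := X ∩ W) (by simp [hxW])] at this
    -- If the trace has size i, X itself counts, but any deletion in W makes it too small; otherwise
    -- X does not count and each of the w deletions in W contributes at most #X / w.
    have hin : (#X : ℝ) * (if X ∈ univ.filter (fun T => #(T ∩ W) = i) then 1 else 0)
        + ∑ x ∈ X ∩ W, relMass (univ.filter fun T => #(T ∩ W) = i) (X.erase x) ≤ #X := by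
      simp only [mem_filter, mem_univ, true_and]
      rcases eq_or_ne (#(X ∩ W)) i with heq | hneq
      · rw [if_pos heq]
        have : ∑ x ∈ X ∩ W, relMass (univ.filter fun T => #(T ∩ W) = i) (X.erase x) = 0 := by
          refine sum_eq_zero fun x hx => ?_
          unfold relMass
          rw [filter_false_of_mem, sum_empty]
          intro S hS hSX
          have h2 := card_le_card (inter_subset_inter_right hSX : S ∩ W ⊆ X.erase x ∩ W)
          have h3 := (mem_filter.1 hS).2
          rw [erase_inter] at h2
          have := card_erase_add_one hx
          omega
        rw [this]; simp
      · rw [if_neg hneq, mul_zero, zero_add]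
        have hw : (0 : ℝ) < #(X ∩ W) := by
          have : 0 < #(X ∩ W) := by omega
          exact_mod_cast this
        have : ∑ x ∈ X ∩ W, relMass (univ.filter fun T => #(T ∩ W) = i) (X.erase x)
            ≤ #(X ∩ W) * ((#X : ℝ) / #(X ∩ W)) := by
          rw [← nsmul_eq_mul, ← sum_const]
          refine sum_le_sum fun x hx => ?_
          have hxX := (mem_inter.1 hx).1
          have h2 := ih _ (erase_ssubset hxX)
          have h3 : ((#((X ∩ W).erase x) : ℝ)) + 1 = #(X ∩ W) := by
            exact_mod_cast card_erase_add_one hx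
          rwa [herase x hxX, erase_inter, h3] at h2
        rwa [mul_div_cancel₀ _ hw.ne'] at this
    refine le_of_mul_le_mul_left ?_ hpos
    have hw1 : (0 : ℝ) < #(X ∩ W) + 1 := by positivity
    have : (#X : ℝ) * ((#X + 1) / (#(X ∩ W) + 1))
        = #X + #(X \ W) * ((#X : ℝ) / (#(X ∩ W) + 1)) := by
      rw [← hcardR]
      field_simp
      ring
    linarith

theorem relMass_card_inter_lt_le [Fintype α] (W : Finset α) (r : ℕ) (X : Finset α) :
    relMass (univ.filter fun T => #(T ∩ W) < r) X
      ≤ r * (((#X : ℝ) + 1) / (#(X ∩ W) + 1)) := by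
  have : relMass (univ.filter fun T => #(T ∩ W) < r) X
      = ∑ i ∈ range r, relMass (univ.filter fun T => #(T ∩ W) = i) X := by
    unfold relMass
    rw [← sum_fiberwise_of_maps_to (t := range r) (g := fun T => #(T ∩ W))]
    · refine sum_congr rfl fun i hi => sum_congr ?_ fun _ _ => rfl
      have := mem_range.1 hi
      ext T
      simp only [mem_filter, mem_univ, true_and]
      constructor
      · rintro ⟨⟨-, h⟩, h'⟩; exact ⟨h', h⟩
      · rintro ⟨h, h'⟩; exact ⟨⟨by omega, h'⟩, h⟩
    · intro T hT
      simp only [mem_filter, mem_univ, true_and] at hT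
      exact mem_range.2 hT.1
  rw [this]
  refine (sum_le_sum fun i _ => relMass_card_inter_eq_le W i X).trans ?_
  rw [sum_const, card_range, nsmul_eq_mul]

end RelMass

/-! ### Weighted Sauer-Shelah. -/

section Shattering

/-- Summation by parts over the level sets of `u`. -/
theorem sum_comp_eq_sum_card_mul {δ : Type*} (G : Finset δ) (u : δ → ℕ) (w : ℕ → ℝ) (M : ℕ)
    (hu : ∀ a ∈ G, u a ≤ M) :
    ∑ a ∈ G, w (u a)
      = #{a ∈ G | u a ≤ M} * w M + ∑ j ∈ range M, #{a ∈ G | u a ≤ j} * (w j - w (j + 1)) := by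
  have h1 : ∀ a ∈ G, w (u a)
      = w M + ∑ j ∈ range M, if u a ≤ j then w j - w (j + 1) else 0 := by
    intro a ha
    rw [← sum_filter]
    have : (range M).filter (fun j => u a ≤ j) = Ico (u a) M := by
      ext j; simp [and_comm]
    rw [this, sum_Ico_eq_sub _ (hu a ha), sum_range_sub', sum_range_sub']
    ring
  rw [sum_congr rfl h1, sum_add_distrib, sum_comm, filter_true_of_mem hu, sum_const, nsmul_eq_mul]
  congr 1
  refine sum_congr rfl fun j _ => ?_
  rw [← sum_filter, sum_const, nsmul_eq_mul]

/-- If at each threshold `F` has at most as many small elements as `D`, then its total weight, for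
a weight that decreases with the size, is at most that of `D`. -/
theorem sum_antitone_le_of_card_le {β γ : Type*} (F : Finset β) (D : Finset γ) (s : β → ℕ)
    (t : γ → ℕ) (w : ℕ → ℝ) (hw : Antitone w) (hw0 : ∀ j, 0 ≤ w j)
    (h : ∀ j, #{a ∈ F | s a ≤ j} ≤ #{b ∈ D | t b ≤ j}) :
    ∑ a ∈ F, w (s a) ≤ ∑ b ∈ D, w (t b) := by
  set M := F.sup s + D.sup t
  rw [sum_comp_eq_sum_card_mul F s w M fun a ha => (le_sup ha).trans (Nat.le_add_right _ _),
    sum_comp_eq_sum_card_mul D t w M fun b hb => (le_sup hb).trans (Nat.le_add_left _ _)]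
  refine add_le_add (mul_le_mul_of_nonneg_right (by exact_mod_cast h M) (hw0 M)) ?_
  refine sum_le_sum fun j _ => mul_le_mul_of_nonneg_right (by exact_mod_cast h j) ?_
  linarith [hw (Nat.le_succ j)]

/-- The truncation at N / 2 is needed because binomial coefficients decrease past the middle. -/
theorem antitone_one_div_choose_min (N : ℕ) :
    Antitone fun s => 1 / (N.choose (min s (N / 2)) : ℝ) := by
  refine antitone_nat_of_succ_le fun s => ?_
  have hpos : 0 < N.choose (min s (N / 2)) := Nat.choose_pos (by omega)
  refine one_div_le_one_div_of_le (by exact_mod_cast hpos) ?_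
  rcases lt_or_ge s (N / 2) with h | h
  · rw [min_eq_left h.le, min_eq_left (by omega : s + 1 ≤ N / 2)]
    exact_mod_cast Nat.choose_le_succ_of_lt_half_left h
  · rw [min_eq_right h, min_eq_right (by omega)]

variable {α : Type*} [DecidableEq α]

/-- A weighted form of the Sauer-Shelah lemma. -/
theorem sum_le_sum_shatterer (G : Finset (Finset α)) (N : ℕ) (s : Finset α → ℕ)
    (hs : ∀ S ∈ G, s S ≤ N / 2)
    (hsh : ∀ j T, {S ∈ G | s S ≤ j}.Shatters T → #T ≤ j) :
    ∑ S ∈ G, 1 / (N.choose (s S) : ℝ) ≤ ∑ T ∈ G.shatterer, 1 / (N.choose #T : ℝ) := by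
  have h := sum_antitone_le_of_card_le G G.shatterer s card
    (fun s => 1 / (N.choose (min s (N / 2)) : ℝ)) (antitone_one_div_choose_min N)
    (fun _ => by positivity) fun j => by
      -- A family shatters at least as many sets as it has members, and those shattered by the part
      -- with s ≤ j have at most j elements.
      refine (card_le_card_shatterer _).trans (card_le_card fun T hT => ?_)
      rw [mem_shatterer] at hT
      exact mem_filter.2 ⟨mem_shatterer.2 (hT.mono_left (filter_subset _ _)), hsh j T hT⟩
  have hT : ∀ T ∈ G.shatterer, #T ≤ N / 2 := by
    intro T hT
    refine hsh _ T ?_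
    rw [filter_true_of_mem hs]
    exact mem_shatterer.1 hT
  refine (le_of_eq (sum_congr rfl fun S hS => ?_)).trans
    (h.trans (le_of_eq (sum_congr rfl fun T hT' => ?_)))
  · rw [min_eq_left (hs S hS)]
  · rw [min_eq_left (hT T hT')]

/-- The factor 2 comes from treating the members in the lower and upper halves of the subsets of A
separately, with size replaced by co-size in the upper half. -/
theorem relMass_le_two_mul_relMass_shatterer (F : Finset (Finset α)) (A : Finset α) :
    relMass F A ≤ 2 * relMass {S ∈ F | S ⊆ A}.shatterer A := by
  set H := {S ∈ F | S ⊆ A} with hH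
  have hHA : ∀ S ∈ H, S ⊆ A := fun S hS => (mem_filter.1 hS).2
  have hbound : ∀ G ⊆ H, ∑ T ∈ G.shatterer, 1 / ((#A).choose #T : ℝ) ≤ relMass H.shatterer A := by
    intro G hG
    refine sum_le_sum_of_subset_of_nonneg (fun T hT => ?_) fun _ _ _ => by positivity
    have hT' := (mem_shatterer.1 hT).mono_left hG
    obtain ⟨S, hS, hTS⟩ := hT'.exists_superset
    exact mem_filter.2 ⟨mem_shatterer.2 hT', hTS.trans (hHA S hS)⟩
  have hlow : ∑ S ∈ H with #S ≤ #A / 2, 1 / ((#A).choose #S : ℝ) ≤ relMass H.shatterer A := by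
    refine (sum_le_sum_shatterer _ (#A) card (fun S hS => (mem_filter.1 hS).2) ?_).trans
      (hbound _ (filter_subset _ _))
    intro j T hT
    obtain ⟨S, hS, hTS⟩ := hT.exists_superset
    exact (card_le_card hTS).trans (mem_filter.1 hS).2
  have hhigh : ∑ S ∈ H with ¬ #S ≤ #A / 2, 1 / ((#A).choose #S : ℝ)
      ≤ relMass H.shatterer A := by
    have := (sum_le_sum_shatterer {S ∈ H | ¬ #S ≤ #A / 2} (#A) (fun S => #A - #S)
      (fun S hS => ?_) ?_).trans (hbound _ (filter_subset _ _))
    · refine le_trans (le_of_eq (sum_congr rfl fun S hS => ?_)) this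
      rw [Nat.choose_symm (card_le_card (hHA S (mem_filter.1 hS).1))]
    · have := (mem_filter.1 hS).2
      omega
    · intro j T hT
      -- A member S disjoint from T bounds #T by the co-size of S.
      obtain ⟨S, hS, hTS⟩ := hT (empty_subset T)
      obtain ⟨S', hS', hTS'⟩ := hT.exists_superset
      simp only [mem_filter] at hS hS'
      have hTA := hTS'.trans (hHA S' hS'.1.1)
      have h1 : #(T ∪ S) ≤ #A := card_le_card (union_subset hTA (hHA S hS.1.1))
      rw [card_union_of_disjoint (disjoint_iff_inter_eq_empty.2 hTS)] at h1
      omega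
  have : relMass F A = ∑ S ∈ H, 1 / ((#A).choose #S : ℝ) := rfl
  rw [this, ← sum_filter_add_sum_filter_not H fun S => #S ≤ #A / 2]
  linarith

/-- A family with large mass below `A` shatters an `r`-element subset of `W ⊆ A`. -/
theorem exists_shatters_of_lt_relMass [Fintype α] (F : Finset (Finset α)) {A W : Finset α}
    (hW : W ⊆ A) (r : ℕ)
    (h : 2 * (r * (((#A : ℝ) + 1) / (#W + 1))) < relMass F A) :
    ∃ T ⊆ W, #T = r ∧ {S ∈ F | S ⊆ A}.Shatters T := by
  by_contra! hcon
  have h1 := relMass_le_two_mul_relMass_shatterer F A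
  have h2 := relMass_card_inter_lt_le W r A
  rw [inter_eq_right.2 hW] at h2
  have h3 : relMass {S ∈ F | S ⊆ A}.shatterer A ≤ relMass (univ.filter fun T => #(T ∩ W) < r) A := by
    refine sum_le_sum_of_subset_of_nonneg (filter_subset_filter _ fun T hT => ?_)
      fun _ _ _ => by positivity
    simp only [mem_filter, mem_univ, true_and]
    -- Shattering is hereditary, so a shattered set with at least r points in W contains a shattered
    -- r-subset of W.
    by_contra! hr
    obtain ⟨T', hT', hcard⟩ := exists_subset_card_eq hr
    exact hcon T' (hT'.trans inter_subset_right) hcard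
      ((mem_shatterer.1 hT).mono_right (hT'.trans inter_subset_left))
  linarith

end Shattering

/-! ### Counting nonpivots. -/

section Pivots

/-- The elements `x ∈ A` for which no member `B` of `F` of the same size as `A` satisfies
`A \ B = {x}`. -/
def nonpivots {α : Type*} [DecidableEq α] (F : Finset (Finset α)) (A : Finset α) : Finset α :=
  {x ∈ A | ∀ B ∈ F, #B = #A → A \ B ≠ {x}}

theorem nonpivots_subset {α : Type*} [DecidableEq α] (F : Finset (Finset α)) (A : Finset α) :
    nonpivots F A ⊆ A :=
  filter_subset _ _

variable {n : ℕ}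

/-- The map (A, x) ↦ A \ {x} is injective on nonpivot pairs: if A \ {x} = B \ {y} and x ∉ B, then A
\ B = {x} with #B = #A, so x is a pivot of A. -/
theorem sum_card_nonpivots_le (F : Finset (Finset (Fin n))) (k : ℕ) :
    ∑ A ∈ F with #A = k + 1, #(nonpivots F A) ≤ n.choose k := by
  rw [← card_sigma]
  have : n.choose k = #(powersetCard k (univ : Finset (Fin n))) := by simp
  rw [this]
  refine card_le_card_of_injOn (fun p => p.1.erase p.2) ?_ ?_
  · rintro ⟨A, x⟩ h
    simp only [coe_sigma, Set.mem_sigma_iff, mem_coe, mem_filter, nonpivots] at h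
    simp only [mem_coe, mem_powersetCard, subset_univ, true_and]
    rw [card_erase_of_mem h.2.1, h.1.2, Nat.add_sub_cancel]
  · rintro ⟨A, x⟩ h ⟨B, y⟩ h' hAB
    simp only [coe_sigma, Set.mem_sigma_iff, mem_coe, mem_filter, nonpivots] at h h' hAB
    have hxB : x ∈ B := by
      by_contra hxB
      refine h.2.2 B h'.1.1 (h'.1.2.trans h.1.2.symm) ?_
      ext z
      simp only [mem_sdiff, mem_singleton]
      constructor
      · rintro ⟨hzA, hzB⟩
        by_contra hzx
        exact hzB (mem_of_mem_erase (hAB ▸ mem_erase.2 ⟨hzx, hzA⟩))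
      · rintro rfl
        exact ⟨h.2.1, hxB⟩
    have hAsub : A ⊆ B := by
      intro z hz
      rcases eq_or_ne z x with rfl | hzx
      · exact hxB
      · exact mem_of_mem_erase (hAB ▸ mem_erase.2 ⟨hzx, hz⟩)
    obtain rfl : A = B := eq_of_subset_of_card_le hAsub (by omega)
    obtain rfl : x = y := by
      by_contra hxy
      have : x ∈ A.erase y := mem_erase.2 ⟨hxy, hxB⟩
      rw [← hAB] at this
      exact notMem_erase x A this
    rfl

theorem sum_one_div_sub_le_log_sub_log (m : ℕ) (hm : m < n) :
    ∑ j ∈ range m, 1 / ((n : ℝ) - j) ≤ Real.log n - Real.log (n - m) := by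
  induction m with
  | zero => simp
  | succ m ih =>
    rw [sum_range_succ]
    have h1 := ih (by omega)
    have hm' : (m : ℝ) + 1 < n := by exact_mod_cast hm
    have hy : (0 : ℝ) < n - m := by linarith
    have hy1 : (0 : ℝ) < n - (m + 1) := by linarith
    have h2 := Real.log_le_sub_one_of_pos (div_pos hy1 hy)
    rw [Real.log_div hy1.ne' hy.ne'] at h2
    have h3 : ((n : ℝ) - (m + 1)) / (n - m) - 1 = - (1 / ((n : ℝ) - m)) := by
      field_simp
      ring
    push_cast
    linarith

theorem sum_half_one_div_sub_le_log_two :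
    ∑ j ∈ range (n / 2), 1 / ((n : ℝ) - j) ≤ Real.log 2 := by
  rcases Nat.eq_zero_or_pos n with rfl | hn
  · simpa using Real.log_nonneg one_le_two
  have hlt : n / 2 < n := by omega
  refine (sum_one_div_sub_le_log_sub_log (n / 2) hlt).trans ?_
  have hn' : (0 : ℝ) < n := by exact_mod_cast hn
  have hhalf : ((n / 2 : ℕ) : ℝ) ≤ n / 2 := Nat.cast_div_le
  have hd : (0 : ℝ) < n - (n / 2 : ℕ) := by linarith
  rw [← Real.log_div hn'.ne' hd.ne']
  refine Real.log_le_log (by positivity) ?_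
  rw [div_le_iff₀ hd]
  linarith

/-- In a family of small sets, the expected proportion of nonpivots, summed over the members on a
random maximal chain, is at most `log 2`. -/
theorem sum_nonpivots_le_log_two (F : Finset (Finset (Fin n))) (hF : ∀ A ∈ F, #A ≤ n / 2) :
    ∑ A ∈ F, (#(nonpivots F A) : ℝ) / (#A * n.choose #A) ≤ Real.log 2 := by
  have hsplit : ∑ A ∈ F, (#(nonpivots F A) : ℝ) / (#A * n.choose #A)
      ≤ ∑ j ∈ range (n / 2), ∑ A ∈ F with #A = j + 1,
        (#(nonpivots F A) : ℝ) / (#A * n.choose #A) := by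
    -- The empty set contributes 0 because division by zero is 0.
    have h0 : ∑ A ∈ F, (#(nonpivots F A) : ℝ) / (#A * n.choose #A)
        = ∑ A ∈ F with #A ≠ 0, (#(nonpivots F A) : ℝ) / (#A * n.choose #A) := by
      refine (sum_filter_of_ne (p := fun A => #A ≠ 0) fun A _ hne h0 => hne ?_).symm
      simp [h0]
    rw [h0, ← sum_fiberwise_of_maps_to (t := range (n / 2)) (g := fun A => #A - 1)]
    · refine le_of_eq (sum_congr rfl fun j _ => sum_congr ?_ fun _ _ => rfl)
      rw [filter_filter]
      refine filter_congr fun A _ => ?_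
      omega
    · intro A hA
      have h1 := (mem_filter.1 hA).2
      have h2 := hF A (mem_filter.1 hA).1
      rw [mem_range]
      omega
  refine hsplit.trans ((sum_le_sum fun j hj => ?_).trans sum_half_one_div_sub_le_log_two)
  have hj' : j < n := by have := mem_range.1 hj; omega
  have hjn : (0 : ℝ) < (n : ℝ) - j := by
    have : (j : ℝ) < n := by exact_mod_cast hj'
    linarith
  have hch : (0 : ℝ) < n.choose j := by exact_mod_cast Nat.choose_pos hj'.le
  have hden : ((j : ℝ) + 1) * n.choose (j + 1) = n.choose j * ((n : ℝ) - j) := by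
    have := Nat.choose_succ_right_eq n j
    rw [← Nat.cast_sub hj'.le]
    rw [mul_comm]
    exact_mod_cast this
  have hcongr : ∑ A ∈ F with #A = j + 1, (#(nonpivots F A) : ℝ) / (#A * n.choose #A)
      = (∑ A ∈ F with #A = j + 1, #(nonpivots F A) : ℕ) / (n.choose j * ((n : ℝ) - j)) := by
    push_cast
    rw [sum_div]
    refine sum_congr rfl fun A hA => ?_
    rw [(mem_filter.1 hA).2, ← hden]
    push_cast
    rfl
  rw [hcongr, div_le_div_iff₀ (by positivity) hjn, one_mul]
  have : ((∑ A ∈ F with #A = j + 1, #(nonpivots F A) : ℕ) : ℝ) ≤ n.choose j := by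
    exact_mod_cast sum_card_nonpivots_le F j
  exact mul_le_mul_of_nonneg_right this hjn.le

end Pivots

/-! ### Building the copy of P. -/

section Embedding

universe u

variable {n : ℕ} {P : Type u} [PartialOrder P]

/-- Pivots of `A` shattered by the members of `F` below `A` give a copy of any poset of height at
most two on as many elements: nonminimal elements go to exchanges of `A` at their pivot, minimal
ones to members of `F` below `A` with prescribed trace on the pivots. -/
theorem containsCopy_of_shatters [Fintype P] (hP : ∀ a b c : P, a < b → ¬ b < c)
    {F G : Finset (Finset (Fin n))} (hGF : G ⊆ F) {A T : Finset (Fin n)}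
    (hTA : T ⊆ A \ nonpivots F A) (hcard : #T = Fintype.card P)
    (hsh : {S ∈ G | S ⊆ A}.Shatters T) : ContainsCopy F P := by
  classical
  obtain ⟨e⟩ : Nonempty (P ≃ T) := ⟨Fintype.equivOfCardEq (by simp [hcard])⟩
  have hpiv : ∀ p : P, ∃ B ∈ F, #B = #A ∧ A \ B = {(e p : Fin n)} := by
    intro p
    have h := mem_sdiff.1 (hTA (e p).2)
    have h2 := h.2
    simp only [nonpivots, mem_filter, not_and, not_forall, not_not] at h2
    obtain ⟨B, hB, hc, hAB⟩ := h2 h.1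
    exact ⟨B, hB, hc, hAB⟩
  choose B hBF hBcard hAB using hpiv
  -- The pivot of p itself separates minimal elements from one another; a nonminimal q has its pivot
  -- left out of S exactly when p < q, which will mean S ⊆ B q.
  have htr : ∀ p : P, ∃ S ∈ G, S ⊆ A ∧
      ∀ q, (e q : Fin n) ∈ S ↔ q = p ∨ ((∃ a, a < q) ∧ ¬ p < q) := by
    intro p
    let U : Finset (Fin n) := ({q : P | q = p ∨ ((∃ a, a < q) ∧ ¬ p < q)} : Finset P).map
      (e.toEmbedding.trans (Function.Embedding.subtype _))
    have hU : ∀ q, (e q : Fin n) ∈ U ↔ q = p ∨ ((∃ a, a < q) ∧ ¬ p < q) := by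
      intro q
      simp [U]
    obtain ⟨S, hS, hTS⟩ := hsh (t := U) (by
      intro x hx
      simp only [U, mem_map] at hx
      obtain ⟨q, -, rfl⟩ := hx
      exact (e q).2)
    obtain ⟨hSG, hSA⟩ := mem_filter.1 hS
    refine ⟨S, hSG, hSA, fun q => ?_⟩
    rw [← hU q, ← hTS, mem_inter]
    simp
  choose S hSG hSA hS using htr
  have heA : ∀ p, (e p : Fin n) ∈ A := fun p => (mem_sdiff.1 (hTA (e p).2)).1
  have hsub : ∀ p X, X ⊆ A → (X ⊆ B p ↔ (e p : Fin n) ∉ X) := by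
    intro p X hX
    constructor
    · intro h hp
      have : (e p : Fin n) ∈ A \ B p := by rw [hAB]; exact mem_singleton_self _
      exact (mem_sdiff.1 this).2 (h hp)
    · intro h x hx
      by_contra hxB
      have : x ∈ A \ B p := mem_sdiff.2 ⟨hX hx, hxB⟩
      rw [hAB, mem_singleton] at this
      exact h (this ▸ hx)
  have hmemB : ∀ p q, (e q : Fin n) ∈ B p ↔ q ≠ p := by
    intro p q
    have := hsub p {(e q : Fin n)} (singleton_subset_iff.2 (heA q))
    rw [singleton_subset_iff, mem_singleton] at this
    rw [this]
    simp [Subtype.ext_iff.symm, eq_comm]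
  let f : P → {X : Finset (Fin n) // X ∈ F} := fun p =>
    if ∃ a, a < p then ⟨B p, hBF p⟩ else ⟨S p, hGF (hSG p)⟩
  have hfB : ∀ p, (∃ a, a < p) → (f p : Finset (Fin n)) = B p := fun p h => by simp only [f, if_pos h]
  have hfS : ∀ p, (¬ ∃ a, a < p) → (f p : Finset (Fin n)) = S p := fun p h => by
    simp only [f, if_neg h]
  refine ⟨OrderEmbedding.ofMapLEIff f fun p q => ?_⟩
  change (f p : Finset (Fin n)) ⊆ f q ↔ _
  by_cases hp : ∃ a, a < p <;> by_cases hq : ∃ a, a < q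
  · rw [hfB p hp, hfB q hq]
    constructor
    · intro h
      by_contra hpq
      have hne : q ≠ p := fun h' => hpq h'.ge
      exact (hmemB q q).1 (h ((hmemB p q).2 hne)) rfl
    · intro h
      rcases h.eq_or_lt with rfl | hlt
      · exact subset_rfl
      -- Height at most two enters here: the nonminimal elements form an antichain.
      · obtain ⟨a, ha⟩ := hp
        exact absurd hlt (hP a p q ha)
  · rw [hfB p hp, hfS q hq]
    constructor
    · intro h
      -- Since B p has the size of A, it fits inside a subset of A only if it equals A, but it
      -- misses a pivot.
      have hBA : B p = A := eq_of_subset_of_card_le (h.trans (hSA q)) (hBcard p).ge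
      have := hAB p
      rw [hBA, sdiff_self] at this
      exact absurd this.symm (singleton_ne_empty _)
    · intro h
      obtain ⟨a, ha⟩ := hp
      exact absurd ⟨a, ha.trans_le h⟩ hq
  · rw [hfS p hp, hfB q hq, hsub q _ (hSA p), hS p q]
    have hne : q ≠ p := by rintro rfl; exact hp hq
    simp only [hne, hq, true_and, false_or, not_not]
    exact ⟨le_of_lt, fun h => lt_of_le_of_ne h hne.symm⟩
  · rw [hfS p hp, hfS q hq]
    constructor
    · intro h
      have := h ((hS p p).2 (Or.inl rfl))
      rw [hS q p] at this
      rcases this with h1 | h1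
      · exact h1.le
      · exact absurd h1.1 hp
    · intro h
      rcases h.eq_or_lt with rfl | hlt
      · exact subset_rfl
      · exact absurd ⟨p, hlt⟩ hq

end Embedding

/-! ### Assembling the bounds on mass and size. -/

section Threshold

universe u

variable {n : ℕ} {P : Type u} [PartialOrder P]

theorem lubellMass_eq_relMass (F : Finset (Finset (Fin n))) : lubellMass F = relMass F univ := by
  rw [lubellMass_eq_sum]
  simp [relMass]

theorem lubellMass_filter_add_filter_not (F : Finset (Finset (Fin n)))
    (p : Finset (Fin n) → Prop) [DecidablePred p] :
    lubellMass F = lubellMass {A ∈ F | p A} + lubellMass {A ∈ F | ¬ p A} := by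
  simp only [lubellMass_eq_sum]
  exact (sum_filter_add_sum_filter_not F p _).symm

theorem lubellMass_image_compl (F : Finset (Finset (Fin n))) :
    lubellMass (F.image compl) = lubellMass F := by
  simp only [lubellMass_eq_sum]
  rw [sum_image compl_injective.injOn]
  refine sum_congr rfl fun A _ => ?_
  rw [card_compl, Fintype.card_fin, Nat.choose_symm (by simpa using card_le_univ A)]

theorem ContainsCopy.of_image_compl {F : Finset (Finset (Fin n))}
    (h : ContainsCopy (F.image compl) Pᵒᵈ) : ContainsCopy F P := by
  obtain ⟨f⟩ := h
  have hmem : ∀ p, ((f p : Finset (Fin n)))ᶜ ∈ F := by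
    intro p
    obtain ⟨A, hA, hAp⟩ := mem_image.1 (f p).2
    rwa [← hAp, compl_compl]
  refine ⟨OrderEmbedding.ofMapLEIff
    (fun p => ⟨((f (OrderDual.toDual p) : Finset (Fin n)))ᶜ, hmem _⟩) fun p q => ?_⟩
  rw [Subtype.mk_le_mk, compl_le_compl_iff_le, Subtype.coe_le_coe, f.le_iff_le,
    OrderDual.toDual_le_toDual]

theorem ContainsCopy.mono {F G : Finset (Finset (Fin n))} (hFG : F ⊆ G) (h : ContainsCopy F P) :
    ContainsCopy G P := by
  obtain ⟨f⟩ := h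
  exact ⟨OrderEmbedding.ofMapLEIff (fun p => ⟨f p, hFG (f p).2⟩) fun p q => by
    rw [Subtype.mk_le_mk, Subtype.coe_le_coe, f.le_iff_le]⟩

theorem not_lt_of_posetHeight_le_two (h : posetHeight P ≤ 2) (a b c : P) (hab : a < b) :
    ¬ b < c := by
  intro hbc
  have hac := hab.trans hbc
  have hchain : IsChain (· ≤ ·) ({a, b, c} : Set P) := by
    rintro x (rfl | rfl | rfl) y (rfl | rfl | rfl) hne <;>
      first
      | exact absurd rfl hne
      | exact Or.inl (le_of_lt ‹_›)
      | exact Or.inr (le_of_lt ‹_›)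
  have h1 := (Set.encard_le_chainHeight_of_isChain _ _ (Set.subset_univ _) hchain).trans h
  have h2 : ({a, b, c} : Set P).encard = 3 :=
    Set.encard_eq_three.2 ⟨a, b, c, hab.ne, hac.ne, hbc.ne, rfl⟩
  rw [h2] at h1
  exact absurd h1 (by decide)

/-- The members of `F` with a proportion of nonpivots above `b / (a + b)` have small mass. -/
theorem lubellMass_filter_nonpivots_le (F : Finset (Finset (Fin n))) (hF : ∀ A ∈ F, #A ≤ n / 2)
    {a b : ℝ} (ha : 0 ≤ a) (hb : 0 < b) (hb2 : b ^ 2 = Real.log 2) :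
    lubellMass {A ∈ F | ¬ (#(nonpivots F A) : ℝ) * (a + b) ≤ b * #A} ≤ b * (a + b) := by
  rw [lubellMass_eq_sum]
  have hab : 0 < a + b := by linarith
  have h1 : ∀ A ∈ ({A ∈ F | ¬ (#(nonpivots F A) : ℝ) * (a + b) ≤ b * #A} : Finset _),
      1 / (n.choose #A : ℝ)
        ≤ (a + b) / b * ((#(nonpivots F A) : ℝ) / (#A * n.choose #A)) := by
    intro A hA
    have hlt := not_le.1 (mem_filter.1 hA).2
    -- The strict inequality fails for the empty set, where the quotient in the Markov bound would
    -- be the default 0.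
    have hApos : (0 : ℝ) < #A := by
      have hle : #(nonpivots F A) ≤ #A := card_le_card (nonpivots_subset F A)
      rcases Nat.eq_zero_or_pos (#A) with h0 | h0
      · have : #(nonpivots F A) = 0 := by omega
        rw [this, h0] at hlt
        simp at hlt
      · exact_mod_cast h0
    have hch : (0 : ℝ) < n.choose #A := by
      exact_mod_cast Nat.choose_pos (by simpa using card_le_univ A)
    rw [div_mul_div_comm, div_le_div_iff₀ hch (by positivity)]
    nlinarith
  refine (sum_le_sum h1).trans ?_
  rw [← mul_sum]
  have h2 : ∑ A ∈ F with ¬ (#(nonpivots F A) : ℝ) * (a + b) ≤ b * #A,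
      (#(nonpivots F A) : ℝ) / (#A * n.choose #A) ≤ b ^ 2 := by
    rw [hb2]
    exact (sum_le_sum_of_subset_of_nonneg (filter_subset _ _) fun _ _ _ => by positivity).trans
      (sum_nonpivots_le_log_two F hF)
  refine (mul_le_mul_of_nonneg_left h2 (by positivity)).trans (le_of_eq ?_)
  field_simp

/-- The threshold splits as (a+b)² = b(a+b) + a(a+b): the first term pays for sets with many
nonpivots, the second is 2r(a+b)/a, the cost of shattering r points among a proportion a/(a+b) of A.
-/
theorem containsCopy_of_card_le_half [Fintype P] (hP : ∀ a b c : P, a < b → ¬ b < c)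
    (F : Finset (Finset (Fin n))) (hF : ∀ A ∈ F, #A ≤ n / 2)
    (h : (√(2 * Fintype.card P) + √(Real.log 2)) ^ 2 < lubellMass F) : ContainsCopy F P := by
  set a := √(2 * Fintype.card P : ℝ) with ha
  set b := √(Real.log 2) with hb
  have ha0 : 0 ≤ a := Real.sqrt_nonneg _
  have hb0 : 0 < b := Real.sqrt_pos.2 (Real.log_pos one_lt_two)
  have ha2 : a ^ 2 = 2 * Fintype.card P := Real.sq_sqrt (by positivity)
  have hb2 : b ^ 2 = Real.log 2 := Real.sq_sqrt (Real.log_pos one_lt_two).le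
  set G : Finset (Finset (Fin n)) := {A ∈ F | (#(nonpivots F A) : ℝ) * (a + b) ≤ b * #A} with hG
  have hmass : a * (a + b) < relMass G univ := by
    have h1 := lubellMass_filter_nonpivots_le F hF ha0 hb0 hb2
    rw [lubellMass_filter_add_filter_not F
      (fun A => (#(nonpivots F A) : ℝ) * (a + b) ≤ b * #A)] at h
    rw [← lubellMass_eq_relMass]
    nlinarith
  obtain ⟨A, hAG, hA⟩ : ∃ A ∈ G, a * (a + b) < relMass G A := by
    by_contra! hcon
    exact absurd (relMass_le_of_forall_mem G (by positivity) hcon univ) (not_le.2 hmass)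
  have hpiv := (mem_filter.1 hAG).2
  have hsub : nonpivots F A ⊆ A := nonpivots_subset F A
  obtain ⟨T, hT, hTcard, hsh⟩ := exists_shatters_of_lt_relMass G
    (sdiff_subset : A \ nonpivots F A ⊆ A) (Fintype.card P) (by
      refine lt_of_le_of_lt ?_ hA
      rw [card_sdiff_of_subset hsub, Nat.cast_sub (card_le_card hsub), ← mul_assoc, ← ha2,
        mul_div_assoc']
      have hle : (#(nonpivots F A) : ℝ) ≤ #A := by exact_mod_cast card_le_card hsub
      rw [div_le_iff₀ (by linarith)]
      have : a * (#A + 1) ≤ (a + b) * (#A - #(nonpivots F A) + 1) := by linarith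
      nlinarith)
  exact containsCopy_of_shatters hP (filter_subset _ _) hT hTcard hsh

theorem containsCopy_of_lt_lubellMass [Fintype P] (hP : ∀ a b c : P, a < b → ¬ b < c)
    (F : Finset (Finset (Fin n)))
    (h : 4 * Fintype.card P + √((32 * Real.log 2) * Fintype.card P) + 6 < lubellMass F) :
    ContainsCopy F P := by
  have hlog : (0 : ℝ) ≤ Real.log 2 := (Real.log_pos one_lt_two).le
  have hlog1 : Real.log 2 ≤ 1 := by
    have := Real.log_le_sub_one_of_pos (zero_lt_two (α := ℝ))
    linarith
  have ha2 : √(2 * Fintype.card P : ℝ) ^ 2 = 2 * Fintype.card P := Real.sq_sqrt (by positivity)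
  have hb2 : √(Real.log 2) ^ 2 = Real.log 2 := Real.sq_sqrt hlog
  have hroot : √((32 * Real.log 2) * Fintype.card P)
      = 4 * (√(2 * Fintype.card P) * √(Real.log 2)) := by
    rw [← Real.sqrt_mul (by positivity), show (32 * Real.log 2) * (Fintype.card P : ℝ)
      = 4 ^ 2 * (2 * Fintype.card P * Real.log 2) by ring, Real.sqrt_mul (by positivity),
      Real.sqrt_sq (by norm_num)]
  by_cases hlow : (√(2 * Fintype.card P) + √(Real.log 2)) ^ 2 < lubellMass {A ∈ F | #A ≤ n / 2}
  · exact (containsCopy_of_card_le_half hP _ (fun A hA => (mem_filter.1 hA).2) hlow).mono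
      (filter_subset _ _)
  · have hsplit := lubellMass_filter_add_filter_not F fun A => #A ≤ n / 2
    have hhigh : (√(2 * Fintype.card Pᵒᵈ) + √(Real.log 2)) ^ 2
        < lubellMass (({A ∈ F | ¬ #A ≤ n / 2} : Finset _).image compl) := by
      rw [lubellMass_image_compl, Fintype.card_orderDual]
      -- Twice the one-sided threshold exceeds the terms in r only by 2 ln 2, which is less than 6.
      nlinarith
    have hcopy : ContainsCopy (({A ∈ F | ¬ #A ≤ n / 2} : Finset _).image compl) Pᵒᵈ := by
      refine containsCopy_of_card_le_half (fun x y z hxy hyz => hP z.ofDual y.ofDual x.ofDual hyz hxy)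
        _ (fun A hA => ?_) hhigh
      obtain ⟨B, hB, rfl⟩ := mem_image.1 hA
      have := (mem_filter.1 hB).2
      rw [card_compl, Fintype.card_fin]
      omega
    exact hcopy.of_image_compl.mono (filter_subset _ _)

theorem card_le_lubellMass_mul_choose (F : Finset (Finset (Fin n))) :
    (#F : ℝ) ≤ lubellMass F * n.choose (n / 2) := by
  rw [lubellMass_eq_sum, sum_mul, card_eq_sum_ones, Nat.cast_sum]
  refine sum_le_sum fun A _ => ?_
  have hch : (0 : ℝ) < n.choose #A := by
    exact_mod_cast Nat.choose_pos (by simpa using card_le_univ A)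
  rw [Nat.cast_one, one_div_mul_eq_div, le_div_iff₀ hch, one_mul]
  exact_mod_cast Nat.choose_le_middle _ _

theorem turanNumber_le [Fintype P] (hP : ∀ a b c : P, a < b → ¬ b < c) (n : ℕ) :
    (turanNumber n P : ℝ)
      ≤ (4 * Fintype.card P + (√(32 * Real.log 2) + 6) * √(Fintype.card P : ℝ))
        * n.choose (n / 2) := by
  classical
  rw [← Nat.le_floor_iff (by positivity)]
  refine Finset.sup_le fun F hF => ?_
  rw [Nat.le_floor_iff (by positivity)]
  have hfree : IsFree F P := (mem_filter.1 hF).2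
  -- A free family forces r ≥ 1, so √r ≥ 1 absorbs the constant 6.
  have hne : Nonempty P := by
    by_contra hemp
    rw [not_nonempty_iff] at hemp
    exact hfree ⟨OrderEmbedding.ofMapLEIff (fun p => isEmptyElim p) fun p => isEmptyElim p⟩
  have hmass := not_lt.1 fun h => hfree (containsCopy_of_lt_lubellMass hP F h)
  have hone : (1 : ℝ) ≤ √(Fintype.card P : ℝ) :=
    Real.one_le_sqrt.2 (by exact_mod_cast Fintype.card_pos)
  refine (card_le_lubellMass_mul_choose F).trans
    (mul_le_mul_of_nonneg_right (hmass.trans ?_) (by positivity))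
  rw [Real.sqrt_mul (by have := Real.log_pos one_lt_two; positivity)]
  linarith

end Threshold

end InducedTuran

theorem theorem3 :
    (∀ (P : Type*) [PartialOrder P] [Fintype P] (r : ℕ), Fintype.card P = r →
      InducedTuran.posetHeight P ≤ 2 →
      InducedTuran.strongLubellThreshold P
          ≤ ((4 * r + √((32 * Real.log 2) * r) + 6 : ℝ) : EReal) ∧
      ∀ (n : ℕ) (F : Finset (Finset (Fin n))),
        4 * r + √((32 * Real.log 2) * r) + 6 < InducedTuran.lubellMass F →
        InducedTuran.ContainsCopy F P) ∧
    (∃ C : ℝ, 0 < C ∧ ∀ (P : Type*) [PartialOrder P] [Fintype P] (r : ℕ), Fintype.card P = r →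
      InducedTuran.posetHeight P ≤ 2 →
      ∀ n : ℕ, (InducedTuran.turanNumber n P : ℝ)
        ≤ (4 * r + C * √(r : ℝ)) * (n.choose (n / 2) : ℝ)) := by
  refine ⟨?_, √(32 * Real.log 2) + 6, by positivity, ?_⟩
  · rintro P _ _ r rfl hP
    have hP' := InducedTuran.not_lt_of_posetHeight_le_two hP
    refine ⟨?_, fun n F h => InducedTuran.containsCopy_of_lt_lubellMass hP' F h⟩
    refine iSup_le fun n => iSup_le fun F => iSup_le fun hF => ?_
    rw [EReal.coe_le_coe_iff]
    exact not_lt.1 fun h => hF (InducedTuran.containsCopy_of_lt_lubellMass hP' F h)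
  · rintro P _ _ r rfl hP n
    exact InducedTuran.turanNumber_le (InducedTuran.not_lt_of_posetHeight_le_two hP) n
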